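/- There are absolute constants $C, c > 0$ such that for every $N$ there is a set $X \subset \mathbb{R}^2$ of exactly $N$ points, no three of them collinear, with $$\mathrm{CON}(X) \le C\,N^{1/3} \qquad\text{and}\qquad \mathrm{CUT}_K(X) \ge c\,\frac{N}{K} \quad\text{for every integer } K \ge 1 .$$ Here $\mathrm{CON}(X)$ is the maximum of $|X \cap J|$ over all convex curves $J$ (boundaries of compact convex regions with nonempty interior), and $$\mathrm{CUT}_K(X) = \min_{\mathcal{A}_K}\ \max_{\text{cells}}\ |X \cap \text{cell}|,$$ where $\mathcal{A}_K$ runs over the simple arrangements of $K$ lines in the plane (no two lines parallel, no three lines through a common point), and the cells of $\mathcal{A}_K$ are the closed regions into which its lines divide the plane (the closures of the connected components of the complement of the union of the lines). -/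

import Mathlib

/-- The Euclidean plane. -/
abbrev Plane : Type := EuclideanSpace ℝ (Fin 2)

/-- A finite set of points is in general position if no three of its points are collinear. -/
def InGeneralPosition (X : Finset Plane) : Prop :=
  ∀ a ∈ X, ∀ b ∈ X, ∀ c ∈ X, a ≠ b → a ≠ c → b ≠ c → ¬ Collinear ℝ {a, b, c}

/-- A (closed) convex curve: the boundary of a compact convex region with nonempty interior. -/
def IsConvexCurve (J : Set Plane) : Prop :=
  ∃ B : Set Plane, IsCompact B ∧ Convex ℝ B ∧ (interior B).Nonempty ∧ J = frontier B

/-- The convex number `CON(X)`: the maximum number of points of `X` on a convex curve. The set of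
these numbers is nonempty and bounded above by the number of points of `X`. -/
noncomputable def convexNumber (X : Finset Plane) : ℕ :=
  sSup {n : ℕ | ∃ J : Set Plane, IsConvexCurve J ∧ n = ((X : Set Plane) ∩ J).ncard}

/-- A simple arrangement: a finite set of lines in the plane, no two of which are parallel and
no three of which meet at a point. -/
structure IsSimpleArrangement (A : Finset (AffineSubspace ℝ Plane)) : Prop where
  line : ∀ ℓ ∈ A, Module.finrank ℝ ℓ.direction = 1
  not_parallel : ∀ ℓ ∈ A, ∀ m ∈ A, ℓ ≠ m → ¬ ℓ.Parallel m
  not_concurrent : ∀ ℓ ∈ A, ∀ m ∈ A, ∀ n ∈ A, ℓ ≠ m → ℓ ≠ n → m ≠ n →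
    ¬ ∃ p : Plane, p ∈ ℓ ∧ p ∈ m ∧ p ∈ n

/-- The union of the lines of an arrangement. -/
def arrangementUnion (A : Finset (AffineSubspace ℝ Plane)) : Set Plane :=
  ⋃ ℓ ∈ A, (ℓ : Set Plane)

/-- The cells of an arrangement: the closed regions into which its lines divide the plane, i.e. the
closures of the connected components of the complement of the union of the lines. A point on a line
belongs to all the cells that it borders, so that every point lies in some cell. For points on
none of the lines this is the same as counting in the open regions. -/
def IsCell (A : Finset (AffineSubspace ℝ Plane)) (c : Set Plane) : Prop :=
  ∃ x ∈ (arrangementUnion A)ᶜ, c = closure (connectedComponentIn (arrangementUnion A)ᶜ x)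

/-- The number of points of `X` in a cell of `A` that contains the most points of `X`. -/
noncomputable def maxCellCount (A : Finset (AffineSubspace ℝ Plane)) (X : Finset Plane) : ℕ :=
  sSup {n : ℕ | ∃ c : Set Plane, IsCell A c ∧ n = ((X : Set Plane) ∩ c).ncard}

/-- The cutting number `CUT_K(X)`: the minimum of `maxCellCount A X` over all simple
arrangements `A` of `K` lines. -/
noncomputable def cuttingNumber (K : ℕ) (X : Finset Plane) : ℕ :=
  sInf {m : ℕ | ∃ A : Finset (AffineSubspace ℝ Plane),
    IsSimpleArrangement A ∧ A.card = K ∧ m = maxCellCount A X}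

/-!
The point set is hierarchical. A chain of level `j + 1` consists of eight tiny copies of the chain
of level `j`, placed along the convex arc `(k, k ^ 2)`, `k < 8`, and squashed so that each copy is
almost vertical, much steeper than any line through two different copies. The coordinates are
exchanged in each copy, and both coordinates increase along the chain.

*Convex curves.* If a convex curve meets a copy, an earlier copy and a later one, it contains only
one point of the middle copy: of two such points the upper one would be interior to the triangle
formed by the lower one and the points of the two other copies. So only the first and the last copy
that a curve meets can contribute more than one point, and the maximal number of points on a convex
curve at most doubles (up to a constant) while the number of points grows by the factor `8`. This
gives the exponent `log 2 / log 8 = 1 / 3` (`WeaklyConvex.card_le`).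

*Cuttings.* Every line hits at most two of the sub-copies of each given level
(`not_hitsBlock_three`). Indeed, it passes through at most two copies by convexity of the arc, and
if it passes through two, its slope is so small that it crosses each of them transversally: it
splits the copy into an initial and a final piece, and so hits at most one sub-copy there. Hence
`K` lines leave a sub-copy unhit at the first level that has more than `2 K` of them, and this
sub-copy, which has a proportion of order `1 / K` of the points, lies in one cell
(`le_maxCellCount_image`).

For a general number `N` of points with `8 ^ j ≤ N < 8 ^ (j + 1)` the first `N` points of the chain
of level `j + 1` serve: they contain its first copy of the chain of level `j`.
-/

/-! ### The nested parabolic chain -/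

/-- The points of the construction. `nestedChain j` lists the `8 ^ j` points with indices
`a < 8 ^ j` (values at larger indices are irrelevant). The chain of level `j + 1` puts a tiny copy
of the chain of level `j` near each of the points `(k, k ^ 2)`, `k < 8`, of a parabola; in the
copy the two coordinates are exchanged and the new first coordinate is compressed so much that
the copy is almost a vertical segment. The leading octal digits of an index name the copies that
contain the point. -/
noncomputable def nestedChain : ℕ → ℕ → ℝ × ℝ
  | 0, _ => 0
  | j + 1, a =>
    (((a / 8 ^ j : ℕ) : ℝ) + (nestedChain j (a % 8 ^ j)).2 / (20000 * 40 ^ j),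
      ((a / 8 ^ j : ℕ) : ℝ) ^ 2 + (nestedChain j (a % 8 ^ j)).1 / 1000)

/-- The small box at the point `(k, k ^ 2)` of the parabola that holds the `k`-th copy. -/
def InBox (k : ℕ) (p : ℝ × ℝ) : Prop :=
  (k : ℝ) ≤ p.1 ∧ p.1 ≤ k + 1 / 100 ∧ (k : ℝ) ^ 2 ≤ p.2 ∧ p.2 ≤ (k : ℝ) ^ 2 + 1 / 100

lemma div_le_seven {j a : ℕ} (ha : a < 8 ^ (j + 1)) : a / 8 ^ j ≤ 7 := by
  have : a / 8 ^ j < 8 := Nat.div_lt_of_lt_mul (by rw [pow_succ] at ha; linarith)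
  omega

lemma nestedChain_bounds (j : ℕ) : ∀ a, a < 8 ^ j →
    0 ≤ (nestedChain j a).1 ∧ (nestedChain j a).1 ≤ 8 ∧
      0 ≤ (nestedChain j a).2 ∧ (nestedChain j a).2 ≤ 64 := by
  induction j with
  | zero => intro a _; simp [nestedChain]
  | succ j ih =>
    intro a ha
    obtain ⟨h1, h2, h3, h4⟩ := ih (a % 8 ^ j) (Nat.mod_lt _ (by positivity))
    have h7 : ((a / 8 ^ j : ℕ) : ℝ) ≤ 7 := by exact_mod_cast div_le_seven ha
    have h0 : (0 : ℝ) ≤ ((a / 8 ^ j : ℕ) : ℝ) := Nat.cast_nonneg _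
    have h40 : (1 : ℝ) ≤ 40 ^ j := one_le_pow₀ (by norm_num)
    have hd : (nestedChain j (a % 8 ^ j)).2 / (20000 * 40 ^ j) ≤ 1 := by
      rw [div_le_one (by positivity)]; linarith
    have hd0 : 0 ≤ (nestedChain j (a % 8 ^ j)).2 / (20000 * 40 ^ j) := by positivity
    simp only [nestedChain]
    refine ⟨by positivity, by linarith, by positivity, ?_⟩
    nlinarith

lemma nestedChain_inBox {j a : ℕ} : InBox (a / 8 ^ j) (nestedChain (j + 1) a) := by
  obtain ⟨h1, h2, h3, h4⟩ := nestedChain_bounds j (a % 8 ^ j) (Nat.mod_lt _ (by positivity))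
  have h40 : (1 : ℝ) ≤ 40 ^ j := one_le_pow₀ (by norm_num)
  have hd : (nestedChain j (a % 8 ^ j)).2 / (20000 * 40 ^ j) ≤ 1 / 100 := by
    rw [div_le_iff₀ (by positivity)]; linarith
  have hd0 : 0 ≤ (nestedChain j (a % 8 ^ j)).2 / (20000 * 40 ^ j) := by positivity
  simp only [nestedChain, InBox]
  refine ⟨by linarith, by linarith, by linarith, by linarith⟩

/-! ### Slopes between boxes and inside a copy -/

lemma InBox.slope_lt {k l : ℕ} {p q : ℝ × ℝ} (hkl : k < l) (hl : l ≤ 7)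
    (hp : InBox k p) (hq : InBox l q) : q.2 - p.2 < 2 * l * (q.1 - p.1) := by
  obtain ⟨h1, h2, h3, h4⟩ := hp
  obtain ⟨h5, h6, h7, h8⟩ := hq
  have hl' : (l : ℝ) ≤ 7 := by exact_mod_cast hl
  have hkl' : (k : ℝ) + 1 ≤ l := by exact_mod_cast hkl
  have hk : (0 : ℝ) ≤ k := Nat.cast_nonneg _
  nlinarith [mul_le_mul_of_nonneg_left (sub_le_sub h5 h2) (by linarith : (0 : ℝ) ≤ 2 * l)]

lemma InBox.lt_slope {k l : ℕ} {p q : ℝ × ℝ} (hkl : k < l) (hk : k ≤ 7)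
    (hp : InBox k p) (hq : InBox l q) : 2 * k * (q.1 - p.1) < q.2 - p.2 := by
  obtain ⟨h1, h2, h3, h4⟩ := hp
  obtain ⟨h5, h6, h7, h8⟩ := hq
  have hl' : (k : ℝ) ≤ 7 := by exact_mod_cast hk
  have hkl' : (k : ℝ) + 1 ≤ l := by exact_mod_cast hkl
  have hk : (0 : ℝ) ≤ k := Nat.cast_nonneg _
  nlinarith [mul_le_mul_of_nonneg_left (sub_le_sub h6 h1) (by linarith : (0 : ℝ) ≤ 2 * k)]

lemma InBox.fst_lt {k l : ℕ} {p q : ℝ × ℝ} (hkl : k < l)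
    (hp : InBox k p) (hq : InBox l q) : p.1 < q.1 := by
  have hkl' : (k : ℝ) + 1 ≤ l := by exact_mod_cast hkl
  linarith [hp.2.1, hq.1]

lemma InBox.fst_sub_le {k l : ℕ} {p q : ℝ × ℝ} (hkl : k < l)
    (hp : InBox k p) (hq : InBox l q) : q.1 - p.1 ≤ 2 * (q.2 - p.2) := by
  obtain ⟨h1, h2, h3, h4⟩ := hp
  obtain ⟨h5, h6, h7, h8⟩ := hq
  have hkl' : (k : ℝ) + 1 ≤ l := by exact_mod_cast hkl
  have hk : (0 : ℝ) ≤ k := Nat.cast_nonneg _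
  nlinarith

lemma InBox.slope_lt_fourteen {k l : ℕ} {p q : ℝ × ℝ} (hkl : k < l) (hl : l ≤ 7)
    (hp : InBox k p) (hq : InBox l q) : q.2 - p.2 < 14 * (q.1 - p.1) := by
  have h := hp.slope_lt hkl hl hq
  have hl' : (l : ℝ) ≤ 7 := by exact_mod_cast hl
  nlinarith [hp.fst_lt hkl hq]

lemma nestedChain_succ_sub {j a b : ℕ} (h : a / 8 ^ j = b / 8 ^ j) :
    (nestedChain (j + 1) b).1 - (nestedChain (j + 1) a).1 =
        ((nestedChain j (b % 8 ^ j)).2 - (nestedChain j (a % 8 ^ j)).2) / (20000 * 40 ^ j) ∧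
      (nestedChain (j + 1) b).2 - (nestedChain (j + 1) a).2 =
        ((nestedChain j (b % 8 ^ j)).1 - (nestedChain j (a % 8 ^ j)).1) / 1000 := by
  simp only [nestedChain, h]
  constructor <;> ring

lemma mod_lt_mod_of_div_eq {n a b : ℕ} (h : a / n = b / n) (hab : a < b) : a % n < b % n := by
  have h1 := Nat.div_add_mod a n
  have h2 := Nat.div_add_mod b n
  rw [h] at h1
  omega

/-- Along the chain both coordinates increase, with slopes between `1 / 2` and `40 ^ j`. -/
lemma nestedChain_slope (j : ℕ) : ∀ a b, a < b → b < 8 ^ j →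
    0 < (nestedChain j b).1 - (nestedChain j a).1 ∧
      (nestedChain j b).1 - (nestedChain j a).1 ≤
        2 * ((nestedChain j b).2 - (nestedChain j a).2) ∧
      (nestedChain j b).2 - (nestedChain j a).2 ≤
        40 ^ j * ((nestedChain j b).1 - (nestedChain j a).1) := by
  induction j with
  | zero => intro a b h1 h2; simp at h2; omega
  | succ j ih =>
    intro a b hab hb
    have h40 : (1 : ℝ) ≤ 40 ^ j := one_le_pow₀ (by norm_num)
    rcases (Nat.div_le_div_right (c := 8 ^ j) hab.le).eq_or_lt with h | h
    · obtain ⟨h1, h2, h3⟩ := ih _ _ (mod_lt_mod_of_div_eq h hab)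
        (Nat.mod_lt _ (by positivity))
      obtain ⟨e1, e2⟩ := nestedChain_succ_sub h
      rw [e1, e2]
      generalize (nestedChain j (b % 8 ^ j)).1 - (nestedChain j (a % 8 ^ j)).1 = d at *
      generalize (nestedChain j (b % 8 ^ j)).2 - (nestedChain j (a % 8 ^ j)).2 = e at *
      refine ⟨by apply div_pos <;> [linarith; positivity], ?_, ?_⟩
      · rw [div_le_iff₀ (by positivity)]; nlinarith
      · have : (40 : ℝ) ^ (j + 1) * (e / (20000 * 40 ^ j)) = e / 500 := by
          field_simp; ring
        rw [this]; linarith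
    · have hp := nestedChain_inBox (j := j) (a := a)
      have hq := nestedChain_inBox (j := j) (a := b)
      have h3 := hp.slope_lt_fourteen h (div_le_seven hb) hq
      have h4 := hp.fst_lt h hq
      refine ⟨by linarith, hp.fst_sub_le h hq, ?_⟩
      rw [pow_succ]
      nlinarith

/-- Inside each copy the chain is steep, compared with the slopes between different copies,
which are less than `14`. -/
lemma nestedChain_steep {j a b : ℕ} (hab : a < b) (h : a / 8 ^ j = b / 8 ^ j) :
    0 < (nestedChain (j + 1) b).1 - (nestedChain (j + 1) a).1 ∧
    20 * ((nestedChain (j + 1) b).1 - (nestedChain (j + 1) a).1) ≤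
      (nestedChain (j + 1) b).2 - (nestedChain (j + 1) a).2 := by
  obtain ⟨h1, h2, h3⟩ := nestedChain_slope j _ _ (mod_lt_mod_of_div_eq h hab)
    (Nat.mod_lt _ (by positivity))
  obtain ⟨e1, e2⟩ := nestedChain_succ_sub h
  rw [e1, e2]
  generalize (nestedChain j (b % 8 ^ j)).1 - (nestedChain j (a % 8 ^ j)).1 = d at *
  generalize (nestedChain j (b % 8 ^ j)).2 - (nestedChain j (a % 8 ^ j)).2 = e at *
  have h40 : (0 : ℝ) < 40 ^ j := by positivity
  refine ⟨by apply div_pos <;> [linarith; positivity], ?_⟩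
  rw [← mul_div_assoc, div_le_iff₀ (by positivity)]
  nlinarith

/-! ### Lines meet at most two blocks of each size -/

/-- The line `u x + v y = w` hits the block of the chain formed by the indices `a` with
`a / 8 ^ i = q`: the block does not lie strictly on one side of the line. -/
def HitsBlock (j : ℕ) (u v w : ℝ) (i q : ℕ) : Prop :=
  (∃ a, a / 8 ^ i = q ∧ w ≤ u * (nestedChain j a).1 + v * (nestedChain j a).2) ∧
    ∃ a, a / 8 ^ i = q ∧ u * (nestedChain j a).1 + v * (nestedChain j a).2 ≤ w

lemma InBox.exists_eq {k : ℕ} {p q : ℝ × ℝ} {u v w : ℝ} (hp : InBox k p) (hq : InBox k q)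
    (h1 : w ≤ u * p.1 + v * p.2) (h2 : u * q.1 + v * q.2 ≤ w) :
    ∃ z, InBox k z ∧ u * z.1 + v * z.2 = w := by
  have hc : IsPreconnected {z : ℝ × ℝ | InBox k z} := by
    have : {z : ℝ × ℝ | InBox k z} =
        Set.Icc (k : ℝ) (k + 1 / 100) ×ˢ Set.Icc ((k : ℝ) ^ 2) ((k : ℝ) ^ 2 + 1 / 100) := by
      ext z; simp [InBox, Prod.le_def]; tauto
    rw [this]
    exact isPreconnected_Icc.prod isPreconnected_Icc
  obtain ⟨z, hz, hzw⟩ := hc.intermediate_value (f := fun z => u * z.1 + v * z.2) hq hp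
    (by fun_prop) ⟨h2, h1⟩
  exact ⟨z, hz, hzw⟩

lemma div_eq_div_of_div_eq {i j a q : ℕ} (hij : i ≤ j) (h : a / 8 ^ i = q) :
    a / 8 ^ j = q / 8 ^ (j - i) := by
  rw [← h, Nat.div_div_eq_div_mul, ← pow_add, Nat.add_sub_cancel' hij]

lemma HitsBlock.exists_inBox {j i q : ℕ} {u v w : ℝ} (hij : i ≤ j)
    (h : HitsBlock (j + 1) u v w i q) :
    ∃ z, InBox (q / 8 ^ (j - i)) z ∧ u * z.1 + v * z.2 = w := by
  obtain ⟨⟨a, ha, ha'⟩, b, hb, hb'⟩ := h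
  have h1 := nestedChain_inBox (j := j) (a := a)
  have h2 := nestedChain_inBox (j := j) (a := b)
  rw [div_eq_div_of_div_eq hij ha] at h1
  rw [div_eq_div_of_div_eq hij hb] at h2
  exact h1.exists_eq h2 ha' hb'

/-- A line that hits a block inside a copy pulls back to a line that hits the corresponding block
of the chain one level below. -/
lemma HitsBlock.mod {j i q : ℕ} {u v w : ℝ} (hij : i ≤ j)
    (h : HitsBlock (j + 1) u v w i q) :
    HitsBlock j (v / 1000) (u / (20000 * 40 ^ j))
      (w - u * (q / 8 ^ (j - i) : ℕ) - v * ((q / 8 ^ (j - i) : ℕ) : ℝ) ^ 2)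
      i (q % 8 ^ (j - i)) := by
  have key : ∀ a, a / 8 ^ i = q →
      (a % 8 ^ j) / 8 ^ i = q % 8 ^ (j - i) ∧
      u * (nestedChain (j + 1) a).1 + v * (nestedChain (j + 1) a).2 =
        v / 1000 * (nestedChain j (a % 8 ^ j)).1 +
          u / (20000 * 40 ^ j) * (nestedChain j (a % 8 ^ j)).2 +
        (u * (q / 8 ^ (j - i) : ℕ) + v * ((q / 8 ^ (j - i) : ℕ) : ℝ) ^ 2) := by
    intro a ha
    constructor
    · rw [← ha, ← Nat.mod_mul_right_div_self, ← pow_add, Nat.add_sub_cancel' hij]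
    · rw [← div_eq_div_of_div_eq hij ha]
      simp only [nestedChain]
      ring
  obtain ⟨⟨a, ha, ha'⟩, b, hb, hb'⟩ := h
  refine ⟨⟨_, (key a ha).1, ?_⟩, _, (key b hb).1, ?_⟩
  · linarith [(key a ha).2]
  · linarith [(key b hb).2]

/-- A line through the boxes of two different copies crosses each copy transversally, so it hits
at most one block of a given size there. -/
lemma not_hitsBlock_of_crosses {j i k l q r : ℕ} {u v w : ℝ} {p z : ℝ × ℝ}
    (huv : u ≠ 0 ∨ v ≠ 0) (hkl : k < l) (hl : l ≤ 7)
    (hp : InBox k p) (hz : InBox l z) (hpw : u * p.1 + v * p.2 = w) (hzw : u * z.1 + v * z.2 = w)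
    (hij : i ≤ j) (hqr : q < r) (hc : q / 8 ^ (j - i) = r / 8 ^ (j - i))
    (hq : HitsBlock (j + 1) u v w i q) (hr : HitsBlock (j + 1) u v w i r) : False := by
  have hx : 0 < z.1 - p.1 := sub_pos.2 (hp.fst_lt hkl hz)
  have hy : z.1 - p.1 ≤ 2 * (z.2 - p.2) := hp.fst_sub_le hkl hz
  have hs := hp.slope_lt_fourteen hkl hl hz
  have h0 : u * (z.1 - p.1) + v * (z.2 - p.2) = 0 := by linarith
  generalize z.1 - p.1 = X at *
  generalize z.2 - p.2 = Y at *
  have hv : v ≠ 0 := by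
    rintro rfl
    have : u = 0 := by
      rcases mul_eq_zero.1 (show u * X = 0 by linarith) with h | h
      · exact h
      · linarith
    simp [this] at huv
  -- the defining form of the line, with the sign of `v`, increases along the copy
  have mono : ∀ a b, a / 8 ^ i = q → b / 8 ^ i = r →
      0 < v * (u * (nestedChain (j + 1) b).1 + v * (nestedChain (j + 1) b).2
        - (u * (nestedChain (j + 1) a).1 + v * (nestedChain (j + 1) a).2)) := by
    intro a b ha hb
    have hab : a < b := by
      by_contra hab
      have := Nat.div_le_div_right (c := 8 ^ i) (not_lt.1 hab)
      omega
    obtain ⟨h1, h2⟩ := nestedChain_steep (j := j) hab (by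
      rw [div_eq_div_of_div_eq hij ha, div_eq_div_of_div_eq hij hb, hc])
    have e : u * (nestedChain (j + 1) b).1 + v * (nestedChain (j + 1) b).2
        - (u * (nestedChain (j + 1) a).1 + v * (nestedChain (j + 1) a).2) =
        u * ((nestedChain (j + 1) b).1 - (nestedChain (j + 1) a).1) +
        v * ((nestedChain (j + 1) b).2 - (nestedChain (j + 1) a).2) := by ring
    rw [e]
    generalize (nestedChain (j + 1) b).1 - (nestedChain (j + 1) a).1 = D at *
    generalize (nestedChain (j + 1) b).2 - (nestedChain (j + 1) a).2 = E at *
    have e2 : X * (v * (u * D + v * E)) = v ^ 2 * (X * E - Y * D) := by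
      linear_combination v * D * h0
    have h3 : 0 < X * E - Y * D := by nlinarith [mul_pos hx h1]
    have h4 : 0 < X * (v * (u * D + v * E)) := by rw [e2]; positivity
    exact pos_of_mul_pos_right h4 hx.le
  obtain ⟨⟨a, ha, ha'⟩, b, hb, hb'⟩ := hq
  obtain ⟨⟨c, hc1, hc'⟩, d, hd, hd'⟩ := hr
  rcases hv.lt_or_gt with hv | hv
  · have := mono b c hb hc1
    nlinarith
  · have := mono a d ha hd
    nlinarith

/-- A line hits at most two blocks of a given size. If it hits only one copy, this is the claim for
the chain one level below. Otherwise it hits at most two copies, because the boxes follow a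
parabola, and it crosses both transversally. -/
theorem not_hitsBlock_three (j : ℕ) : ∀ u v w : ℝ, (u ≠ 0 ∨ v ≠ 0) → ∀ i ≤ j, ∀ q r s,
    q < r → r < s → s < 8 ^ (j - i) →
    HitsBlock j u v w i q → HitsBlock j u v w i r → HitsBlock j u v w i s → False := by
  induction j with
  | zero =>
    intro u v w _ i hi q r s hqr hrs hs
    simp at hs
    omega
  | succ j ih =>
    intro u v w huv i hi q r s hqr hrs hs hq hr hs'
    rcases hi.eq_or_lt with rfl | hi
    · simp at hs
      omega
    have hij : i ≤ j := by omega
    have hm : 0 < 8 ^ (j - i) := by positivity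
    have hs7 : s / 8 ^ (j - i) ≤ 7 := by
      apply div_le_seven
      rwa [← Nat.sub_add_comm hij]
    have hle1 := Nat.div_le_div_right (c := 8 ^ (j - i)) hqr.le
    have hle2 := Nat.div_le_div_right (c := 8 ^ (j - i)) hrs.le
    obtain ⟨zq, bq, eq⟩ := hq.exists_inBox hij
    obtain ⟨zr, br, er⟩ := hr.exists_inBox hij
    obtain ⟨zs, bs, es⟩ := hs'.exists_inBox hij
    rcases hle1.eq_or_lt with h1 | h1
    · rcases hle2.eq_or_lt with h2 | h2
      · have hq2 := hq.mod hij
        have hr2 := hr.mod hij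
        have hs2 := hs'.mod hij
        rw [h1, h2] at hq2
        rw [h2] at hr2
        refine ih _ _ _ ?_ i hij _ _ _ (mod_lt_mod_of_div_eq h1 hqr) (mod_lt_mod_of_div_eq h2 hrs)
          (Nat.mod_lt _ hm) hq2 hr2 hs2
        rcases huv with h | h
        · exact Or.inr (div_ne_zero h (by positivity))
        · exact Or.inl (div_ne_zero h (by positivity))
      · exact not_hitsBlock_of_crosses huv h2 hs7 br bs er es hij hqr h1 hq hr
    · rcases hle2.eq_or_lt with h2 | h2
      · exact not_hitsBlock_of_crosses huv h1 (by omega) bq br eq er hij hrs h2 hr hs'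
      · have s1 := bq.slope_lt h1 (by omega) br
        have s2 := br.lt_slope h2 (by omega) bs
        have x1 := sub_pos.2 (bq.fst_lt h1 br)
        have x2 := sub_pos.2 (br.fst_lt h2 bs)
        generalize (2 * ((r / 8 ^ (j - i) : ℕ) : ℝ)) = t at *
        have e1 : u * (zr.1 - zq.1) + v * (zr.2 - zq.2) = 0 := by linarith
        have e2 : u * (zs.1 - zr.1) + v * (zs.2 - zr.2) = 0 := by linarith
        generalize zr.1 - zq.1 = X at *
        generalize zr.2 - zq.2 = Y at *
        generalize zs.1 - zr.1 = X' at *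
        generalize zs.2 - zr.2 = Y' at *
        have hdet : 0 < X * Y' - Y * X' := by nlinarith
        have hv : v = 0 := by
          have : v * (X * Y' - Y * X') = 0 := by linear_combination X * e2 - X' * e1
          exact (mul_eq_zero.1 this).resolve_right hdet.ne'
        have hu : u = 0 := by
          have : u * X = 0 := by rw [hv] at e1; linarith
          exact (mul_eq_zero.1 this).resolve_right (by linarith)
        simp [hu, hv] at huv

/-! ### Subsets of the chain in weakly convex position -/

/-- The points of the chain with indices in `S` lie on the boundary of their convex hull: through
each of them there is a line with all of them on one closed side. -/
def WeaklyConvex (j : ℕ) (S : Finset ℕ) : Prop :=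
  ∀ a ∈ S, ∃ u v : ℝ, (u ≠ 0 ∨ v ≠ 0) ∧ ∀ b ∈ S,
    u * (nestedChain j b).1 + v * (nestedChain j b).2 ≤
      u * (nestedChain j a).1 + v * (nestedChain j a).2

/-- The part of a weakly convex set in one copy, read one level below, is weakly convex. -/
lemma WeaklyConvex.copy {j : ℕ} {S : Finset ℕ} (h : WeaklyConvex (j + 1) S) (k : ℕ) :
    WeaklyConvex j ((S.filter (fun a => a / 8 ^ j = k)).image (· % 8 ^ j)) := by
  intro r hr
  simp only [Finset.mem_image, Finset.mem_filter] at hr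
  obtain ⟨a, ⟨haS, hak⟩, rfl⟩ := hr
  obtain ⟨u, v, huv, H⟩ := h a haS
  refine ⟨v / 1000, u / (20000 * 40 ^ j), ?_, ?_⟩
  · rcases huv with h | h
    · exact Or.inr (div_ne_zero h (by positivity))
    · exact Or.inl (div_ne_zero h (by positivity))
  · intro r hr
    simp only [Finset.mem_image, Finset.mem_filter] at hr
    obtain ⟨b, ⟨hbS, hbk⟩, rfl⟩ := hr
    have H' := H b hbS
    simp only [nestedChain, hak, hbk] at H'
    have e : ∀ x y : ℝ, v / 1000 * x + u / (20000 * 40 ^ j) * y =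
      u * (k + y / (20000 * 40 ^ j)) + v * ((k : ℝ) ^ 2 + x / 1000) -
        (u * k + v * (k : ℝ) ^ 2) := by
      intro x y; ring
    rw [e, e]
    linarith

/-- Two points of one copy cannot be in weakly convex position together with a point of an earlier
and a point of a later copy: the upper one of the two lies inside the triangle of the others. -/
lemma WeaklyConvex.eq_of_div_eq {j : ℕ} {S : Finset ℕ} (h : WeaklyConvex (j + 1) S)
    {a b b' c : ℕ} (ha : a ∈ S) (hb : b ∈ S) (hb' : b' ∈ S) (hc : c ∈ S)
    (hab : a / 8 ^ j < b / 8 ^ j) (hbc : b / 8 ^ j < c / 8 ^ j) (hc8 : c < 8 ^ (j + 1))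
    (hbb : b / 8 ^ j = b' / 8 ^ j) : b = b' := by
  wlog hlt : b' < b generalizing b b'
  · rcases (not_lt.1 hlt).eq_or_lt with h1 | h1
    · exact h1
    · exact (this hb' hb (hbb ▸ hab) (hbb ▸ hbc) hbb.symm h1).symm
  exfalso
  obtain ⟨u, v, huv, H⟩ := h b hb
  have ia := nestedChain_inBox (j := j) (a := a)
  have ib := nestedChain_inBox (j := j) (a := b)
  have ic := nestedChain_inBox (j := j) (a := c)
  have hc7 := div_le_seven hc8
  have s1 := ia.slope_lt hab (by omega) ib
  have s2 := ib.lt_slope hbc (by omega) ic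
  have s3 := ib.slope_lt_fourteen hbc hc7 ic
  have x1 := ia.fst_lt hab ib
  have x2 := ib.fst_lt hbc ic
  obtain ⟨t1, t2⟩ := nestedChain_steep hlt hbb.symm
  have e1 := H a ha
  have e2 := H b' hb'
  have e3 := H c hc
  generalize (2 * ((b / 8 ^ j : ℕ) : ℝ)) = t at *
  generalize (nestedChain (j + 1) a) = pa at *
  generalize (nestedChain (j + 1) b) = pb at *
  generalize (nestedChain (j + 1) b') = pb' at *
  generalize (nestedChain (j + 1) c) = pc at *
  have e1 : 0 ≤ u * (pb.1 - pa.1) + v * (pb.2 - pa.2) := by linarith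
  have e2 : 0 ≤ u * (pb.1 - pb'.1) + v * (pb.2 - pb'.2) := by linarith
  have e3 : u * (pc.1 - pb.1) + v * (pc.2 - pb.2) ≤ 0 := by linarith
  have x1 : 0 < pb.1 - pa.1 := by linarith
  have x2 : 0 < pc.1 - pb.1 := by linarith
  generalize pb.1 - pa.1 = X at *
  generalize pb.2 - pa.2 = Y at *
  generalize pc.1 - pb.1 = X' at *
  generalize pc.2 - pb.2 = Y' at *
  generalize pb.1 - pb'.1 = D at *
  generalize pb.2 - pb'.2 = E at *
  have d1 : 0 < X * Y' - Y * X' := by nlinarith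
  have d2 : 0 < X' * E - Y' * D := by nlinarith [mul_pos x2 t1]
  have v1 : v * (X * Y' - Y * X') ≤ 0 := by
    linarith [mul_nonneg x2.le e1, mul_nonneg x1.le (neg_nonneg.2 e3)]
  have v2 : 0 ≤ v * (X' * E - Y' * D) := by
    linarith [mul_nonneg x2.le e2, mul_nonneg t1.le (neg_nonneg.2 e3)]
  have hv : v = 0 := le_antisymm (nonpos_of_mul_nonpos_left v1 d1) (nonneg_of_mul_nonneg_left v2 d2)
  subst hv
  have hu : u = 0 := by
    apply le_antisymm <;> nlinarith
  simp [hu] at huv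

/-- A weakly convex set has at most one point in each copy strictly between the first and the last
copy it meets, so its size at most doubles, up to a constant, from one level to the next. -/
theorem WeaklyConvex.card_le (j : ℕ) : ∀ S : Finset ℕ, (∀ a ∈ S, a < 8 ^ j) →
    WeaklyConvex j S → S.card + 8 ≤ 9 * 2 ^ j := by
  induction j with
  | zero =>
    intro S hS _
    have : S ⊆ Finset.range 1 := fun a ha => by simpa using hS a ha
    have := Finset.card_le_card this
    simp at this
    simpa using this
  | succ j ih =>
    intro S hS h
    have hcopy : ∀ k, (S.filter (fun a => a / 8 ^ j = k)).card + 8 ≤ 9 * 2 ^ j := by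
      intro k
      rw [← Finset.card_image_of_injOn (f := (· % 8 ^ j))]
      · refine ih _ ?_ (h.copy k)
        intro r hr
        simp only [Finset.mem_image] at hr
        obtain ⟨a, _, rfl⟩ := hr
        exact Nat.mod_lt _ (by positivity)
      · intro a ha b hb hab
        simp only [Finset.coe_filter, Set.mem_ofPred_eq] at ha hb
        rw [← Nat.div_add_mod a (8 ^ j), ← Nat.div_add_mod b (8 ^ j), ha.2, hb.2]
        exact congrArg _ hab
    rcases S.eq_empty_or_nonempty with rfl | hne
    · have : 1 ≤ 2 ^ (j + 1) := Nat.one_le_two_pow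
      simp; omega
    obtain ⟨a, ha, hmin⟩ := S.exists_min_image (· / 8 ^ j) hne
    obtain ⟨c, hc, hmax⟩ := S.exists_max_image (· / 8 ^ j) hne
    have hsub : S ⊆ (S.filter (fun b => b / 8 ^ j = a / 8 ^ j) ∪
        S.filter (fun b => b / 8 ^ j = c / 8 ^ j)) ∪
        S.filter (fun b => a / 8 ^ j < b / 8 ^ j ∧ b / 8 ^ j < c / 8 ^ j) := by
      intro b hb
      have h1 := hmin b hb
      have h2 := hmax b hb
      simp only [Finset.mem_union, Finset.mem_filter, hb, true_and]
      omega
    have hmid : (S.filter (fun b => a / 8 ^ j < b / 8 ^ j ∧ b / 8 ^ j < c / 8 ^ j)).card ≤ 8 := by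
      rw [← Finset.card_range 8]
      apply Finset.card_le_card_of_injOn (· / 8 ^ j)
      · intro b hb
        simp only [Finset.coe_filter, Set.mem_ofPred_eq] at hb
        have := div_le_seven (hS b hb.1)
        simp only [Finset.coe_range, Set.mem_Iio]
        omega
      · intro b hb b' hb' hbb
        simp only [Finset.coe_filter, Set.mem_ofPred_eq] at hb hb'
        exact h.eq_of_div_eq ha hb.1 hb'.1 hc hb.2.1 hb.2.2 (hS c hc) hbb
    have h1 := Finset.card_le_card hsub
    have h2 := Finset.card_union_le (S.filter (fun b => b / 8 ^ j = a / 8 ^ j) ∪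
        S.filter (fun b => b / 8 ^ j = c / 8 ^ j))
        (S.filter (fun b => a / 8 ^ j < b / 8 ^ j ∧ b / 8 ^ j < c / 8 ^ j))
    have h3 := Finset.card_union_le (S.filter (fun b => b / 8 ^ j = a / 8 ^ j))
        (S.filter (fun b => b / 8 ^ j = c / 8 ^ j))
    have h4 := hcopy (a / 8 ^ j)
    have h5 := hcopy (c / 8 ^ j)
    rw [pow_succ]
    omega

/-! ### Lines, cells and convex curves in coordinates -/

lemma clm_apply_eq (f : Plane →L[ℝ] ℝ) (p : Plane) :
    f p = f !₂[1, 0] * p 0 + f !₂[0, 1] * p 1 := by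
  have : p = p 0 • (!₂[1, 0] : Plane) + p 1 • (!₂[0, 1] : Plane) := by
    ext i; fin_cases i <;> simp
  conv_lhs => rw [this]
  rw [map_add, map_smul, map_smul, smul_eq_mul, smul_eq_mul]
  ring

lemma exists_line_equation {ℓ : AffineSubspace ℝ Plane} (h : Module.finrank ℝ ℓ.direction = 1) :
    ∃ u v w : ℝ, (u ≠ 0 ∨ v ≠ 0) ∧ ∀ p : Plane, p ∈ ℓ ↔ u * p 0 + v * p 1 = w := by
  obtain ⟨p₀, hp₀⟩ : (ℓ : Set Plane).Nonempty := by
    rw [AffineSubspace.nonempty_iff_ne_bot]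
    rintro rfl
    rw [AffineSubspace.direction_bot, finrank_bot] at h
    exact zero_ne_one h
  obtain ⟨⟨d, hd⟩, hd0, hspan⟩ := finrank_eq_one_iff'.1 h
  have hd0' : d ≠ 0 := fun h => hd0 (Subtype.ext h)
  have hnz : d 0 ≠ 0 ∨ d 1 ≠ 0 := by
    by_contra! hcon
    apply hd0'
    ext i; fin_cases i
    · exact hcon.1
    · exact hcon.2
  refine ⟨-d 1, d 0, -d 1 * p₀ 0 + d 0 * p₀ 1, ?_, fun p => ?_⟩
  · rcases hnz with h | h
    · exact Or.inr h
    · exact Or.inl (neg_ne_zero.2 h)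
  · have hmem : p ∈ ℓ ↔ p - p₀ ∈ ℓ.direction := by
      rw [← vsub_eq_sub, AffineSubspace.vsub_right_mem_direction_iff_mem hp₀]
    rw [hmem]
    constructor
    · intro hp
      obtain ⟨c, hc⟩ := hspan ⟨p - p₀, hp⟩
      have hc : c • d = p - p₀ := congrArg Subtype.val hc
      have h0 := congrArg (fun z : Plane => z 0) hc
      have h1 := congrArg (fun z : Plane => z 1) hc
      simp at h0 h1
      linear_combination d 1 * h0 - d 0 * h1
    · intro hp
      have key : ∃ c : ℝ, p - p₀ = c • d := by
        rcases hnz with h | h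
        · refine ⟨(p 0 - p₀ 0) / d 0, ?_⟩
          ext i; fin_cases i
          · simp; field_simp
          · simp; field_simp; linarith
        · refine ⟨(p 1 - p₀ 1) / d 1, ?_⟩
          ext i; fin_cases i
          · simp; field_simp; linarith
          · simp; field_simp
      obtain ⟨c, hc⟩ := key
      rw [hc]
      exact ℓ.direction.smul_mem c hd

lemma exists_equation_of_collinear {a b c : Plane} (hab : a ≠ b)
    (h : Collinear ℝ {a, b, c}) :
    ∃ u v w : ℝ, (u ≠ 0 ∨ v ≠ 0) ∧ u * a 0 + v * a 1 = w ∧ u * b 0 + v * b 1 = w ∧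
      u * c 0 + v * c 1 = w := by
  obtain ⟨d, hd⟩ := (collinear_iff_of_mem (p₀ := a) (by simp)).1 h
  obtain ⟨r, hr⟩ := hd b (by simp)
  obtain ⟨s, hs⟩ := hd c (by simp)
  refine ⟨-d 1, d 0, -d 1 * a 0 + d 0 * a 1, ?_, rfl, ?_, ?_⟩
  · by_contra! hcon
    apply hab
    rw [hr]
    ext i; fin_cases i
    · simp [hcon.2]
    · simp [neg_eq_zero.1 hcon.1]
  · rw [hr]; simp; ring
  · rw [hs]; simp; ring

/-- A convex set that avoids the lines lies in one cell, together with its limit points. -/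
lemma exists_isCell_of_convex {A : Finset (AffineSubspace ℝ Plane)} {D : Set Plane}
    (hD : Convex ℝ D) (hne : D.Nonempty) (hdisj : D ⊆ (arrangementUnion A)ᶜ) :
    ∃ c, IsCell A c ∧ closure D ⊆ c := by
  obtain ⟨x, hx⟩ := hne
  exact ⟨_, ⟨x, hdisj hx, rfl⟩,
    closure_mono (hD.isPreconnected.subset_connectedComponentIn hx hdisj)⟩

/-- Every point of the plane lies in some closed cell: a short segment that starts at the point, in
a direction parallel to none of the lines, avoids the lines apart from its starting point. -/
lemma exists_isCell_mem {A : Finset (AffineSubspace ℝ Plane)}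
    (hA : ∀ ℓ ∈ A, Module.finrank ℝ ℓ.direction = 1) (p : Plane) :
    ∃ c, IsCell A c ∧ p ∈ c := by
  have : ∀ ℓ : A, ∃ e : ℝ × ℝ × ℝ, (e.1 ≠ 0 ∨ e.2.1 ≠ 0) ∧
      ∀ p : Plane, p ∈ (ℓ : AffineSubspace ℝ Plane) ↔ e.1 * p 0 + e.2.1 * p 1 = e.2.2 := by
    rintro ⟨ℓ, hℓ⟩
    obtain ⟨u, v, w, h⟩ := exists_line_equation (hA ℓ hℓ)
    exact ⟨(u, v, w), h⟩
  choose e he hmem using this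
  obtain ⟨s, hs⟩ := Infinite.exists_notMem_finset
    (Finset.univ.image fun ℓ : A => -(e ℓ).1 / (e ℓ).2.1)
  have hs' : ∀ ℓ : A, (e ℓ).1 + (e ℓ).2.1 * s ≠ 0 := by
    intro ℓ h
    rcases eq_or_ne (e ℓ).2.1 0 with h0 | h0
    · rcases he ℓ with h1 | h1
      · rw [h0] at h; simp at h; exact h1 h
      · exact h1 h0
    · apply hs
      simp only [Finset.mem_image, Finset.mem_univ, true_and]
      exact ⟨ℓ, by rw [div_eq_iff h0]; linarith⟩
  have hev : ∀ ℓ : A, ∀ᶠ t : ℝ in nhdsWithin 0 (Set.Ioi 0),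
      (e ℓ).1 * p 0 + (e ℓ).2.1 * p 1 - (e ℓ).2.2 + t * ((e ℓ).1 + (e ℓ).2.1 * s) ≠ 0 := by
    intro ℓ
    rcases eq_or_ne ((e ℓ).1 * p 0 + (e ℓ).2.1 * p 1 - (e ℓ).2.2) 0 with h0 | h0
    · rw [h0]
      filter_upwards [self_mem_nhdsWithin] with t ht
      rw [zero_add]
      exact mul_ne_zero (ne_of_gt ht) (hs' ℓ)
    · apply nhdsWithin_le_nhds
      apply ContinuousAt.eventually_ne (by fun_prop)
      simpa using h0
  obtain ⟨ε, hε, hsub⟩ := mem_nhdsGT_iff_exists_Ioo_subset.1 (Filter.eventually_all.2 hev)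
  have hε : (0 : ℝ) < ε := hε
  set g : ℝ →ᵃ[ℝ] Plane := AffineMap.lineMap p (p + !₂[1, s]) with hg
  have hg' : ∀ t, g t = t • (!₂[1, s] : Plane) + p := by
    intro t; simp [hg, AffineMap.lineMap_apply]
  obtain ⟨c, hc, hcl⟩ := exists_isCell_of_convex (A := A) (D := g '' Set.Ioo 0 ε)
    ((convex_Ioo 0 ε).affine_image g) ((Set.nonempty_Ioo.2 hε).image g) (by
      rintro _ ⟨t, ht, rfl⟩ hmem'
      simp only [arrangementUnion, Set.mem_iUnion] at hmem'
      obtain ⟨ℓ, hℓ, hin⟩ := hmem'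
      have h1 := hsub ht ⟨ℓ, hℓ⟩
      apply h1
      have h2 := (hmem ⟨ℓ, hℓ⟩ (g t)).1 hin
      rw [hg'] at h2
      simp at h2
      linear_combination h2)
  refine ⟨c, hc, hcl ?_⟩
  have hcont : Continuous g := AffineMap.continuous_of_finiteDimensional g
  have h0 : (0 : ℝ) ∈ closure (Set.Ioo 0 ε) := by
    rw [closure_Ioo hε.ne]; exact ⟨le_rfl, hε.le⟩
  have := image_closure_subset_closure_image hcont (Set.mem_image_of_mem g h0)
  simpa [hg'] using this

lemma le_maxCellCount {A : Finset (AffineSubspace ℝ Plane)} {X T : Finset Plane} {c : Set Plane}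
    (hc : IsCell A c) (hTX : T ⊆ X) (hT : (T : Set Plane) ⊆ c) :
    T.card ≤ maxCellCount A X := by
  have h1 : T.card ≤ ((X : Set Plane) ∩ c).ncard := by
    rw [← Set.ncard_coe_finset]
    exact Set.ncard_le_ncard (Set.subset_inter (by exact_mod_cast hTX) hT)
      (X.finite_toSet.inter_of_left c)
  refine h1.trans (le_csSup ⟨X.card, ?_⟩ ⟨c, hc, rfl⟩)
  rintro n ⟨c, _, rfl⟩
  rw [← Set.ncard_coe_finset X]
  exact Set.ncard_le_ncard Set.inter_subset_left X.finite_toSet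

/-- The tangent `y = 2 k x - k ^ 2` of the parabola `y = x ^ 2`. -/
noncomputable def parabolaTangent (k : ℕ) : AffineSubspace ℝ Plane :=
  AffineSubspace.mk' !₂[0, -(k : ℝ) ^ 2] (Submodule.span ℝ {!₂[1, 2 * (k : ℝ)]})

lemma mem_parabolaTangent {k : ℕ} {p : Plane} (h : p ∈ parabolaTangent k) :
    p 1 = 2 * k * p 0 - (k : ℝ) ^ 2 := by
  rw [parabolaTangent, AffineSubspace.mem_mk', vsub_eq_sub, Submodule.mem_span_singleton] at h
  obtain ⟨c, hc⟩ := h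
  have h0 := congrArg (fun z : Plane => z 0) hc
  have h1 := congrArg (fun z : Plane => z 1) hc
  simp at h0 h1
  rw [← h0]
  linarith

lemma not_parallel_parabolaTangent {k l : ℕ} (hkl : k ≠ l) :
    ¬ (parabolaTangent k).Parallel (parabolaTangent l) := by
  intro h
  have h := h.direction_eq
  simp only [parabolaTangent, AffineSubspace.direction_mk'] at h
  have h2 : (!₂[1, 2 * (k : ℝ)] : Plane) ∈ Submodule.span ℝ {(!₂[1, 2 * (l : ℝ)] : Plane)} := by
    rw [← h]; exact Submodule.mem_span_singleton_self _
  obtain ⟨c, hc⟩ := Submodule.mem_span_singleton.1 h2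
  have h0 := congrArg (fun z : Plane => z 0) hc
  have h1 := congrArg (fun z : Plane => z 1) hc
  simp at h0 h1
  subst h0
  apply hkl
  have : (l : ℝ) = k := by linarith
  exact_mod_cast this.symm

lemma exists_isSimpleArrangement (K : ℕ) :
    ∃ A : Finset (AffineSubspace ℝ Plane), IsSimpleArrangement A ∧ A.card = K := by
  classical
  have hne : ∀ k l : ℕ, parabolaTangent k ≠ parabolaTangent l → k ≠ l :=
    fun k l h hkl => h (hkl ▸ rfl)
  refine ⟨(Finset.range K).image parabolaTangent, ⟨?_, ?_, ?_⟩, ?_⟩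
  · intro ℓ hℓ
    obtain ⟨k, _, rfl⟩ := Finset.mem_image.1 hℓ
    rw [parabolaTangent, AffineSubspace.direction_mk']
    apply finrank_span_singleton
    intro h
    simpa using congrArg (fun z : Plane => z 0) h
  · intro ℓ hℓ m hm h
    obtain ⟨k, _, rfl⟩ := Finset.mem_image.1 hℓ
    obtain ⟨l, _, rfl⟩ := Finset.mem_image.1 hm
    exact not_parallel_parabolaTangent (hne _ _ h)
  · rintro ℓ hℓ m hm n hn h1 h2 h3 ⟨p, hp1, hp2, hp3⟩
    obtain ⟨k, _, rfl⟩ := Finset.mem_image.1 hℓ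
    obtain ⟨l, _, rfl⟩ := Finset.mem_image.1 hm
    obtain ⟨r, _, rfl⟩ := Finset.mem_image.1 hn
    have e1 := mem_parabolaTangent hp1
    have e2 := mem_parabolaTangent hp2
    have e3 := mem_parabolaTangent hp3
    have n1 : (k : ℝ) - l ≠ 0 := sub_ne_zero.2 (by exact_mod_cast hne _ _ h1)
    have n2 : (k : ℝ) - r ≠ 0 := sub_ne_zero.2 (by exact_mod_cast hne _ _ h2)
    have n3 : (l : ℝ) - r ≠ 0 := sub_ne_zero.2 (by exact_mod_cast hne _ _ h3)
    -- two tangents meet above the midpoint of their parameters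
    have m1 : (k : ℝ) + l = 2 * p 0 := by
      apply mul_left_cancel₀ n1; linear_combination e1 - e2
    have m2 : (k : ℝ) + r = 2 * p 0 := by
      apply mul_left_cancel₀ n2; linear_combination e1 - e3
    exact n3 (by linarith)
  · rw [Finset.card_image_of_injective, Finset.card_range]
    intro k l h
    by_contra hkl
    exact not_parallel_parabolaTangent hkl (h ▸ AffineSubspace.Parallel.refl _)

/-- A convex curve has a supporting line at each of its points. -/
lemma IsConvexCurve.exists_supporting_line {J : Set Plane} (hJ : IsConvexCurve J) {p : Plane}
    (hp : p ∈ J) : ∃ u v : ℝ, (u ≠ 0 ∨ v ≠ 0) ∧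
      ∀ q ∈ J, u * q 0 + v * q 1 ≤ u * p 0 + v * p 1 := by
  obtain ⟨B, hBc, hB, ⟨z, hz⟩, rfl⟩ := hJ
  obtain ⟨f, hf⟩ := geometric_hahn_banach_open_point hB.interior isOpen_interior hp.2
  refine ⟨f !₂[1, 0], f !₂[0, 1], ?_, fun q hq => ?_⟩
  · by_contra! hcon
    have := hf z hz
    rw [clm_apply_eq f z, clm_apply_eq f p, hcon.1, hcon.2] at this
    simp at this
  · rw [← clm_apply_eq, ← clm_apply_eq]
    have hq' : q ∈ closure (interior B) := by
      rw [hB.closure_interior_eq_closure_of_nonempty_interior ⟨z, hz⟩]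
      exact hq.1
    exact closure_minimal (fun x hx => (hf x hx).le)
      (isClosed_le f.continuous continuous_const) hq'

/-! ### The chain as a set of points of the plane -/

/-- The points of the chain as points of the Euclidean plane. -/
noncomputable def chainPoint (j a : ℕ) : Plane := !₂[(nestedChain j a).1, (nestedChain j a).2]

lemma chainPoint_zero (j a : ℕ) : chainPoint j a 0 = (nestedChain j a).1 := rfl

lemma chainPoint_one (j a : ℕ) : chainPoint j a 1 = (nestedChain j a).2 := rfl

lemma chainPoint_injOn (j : ℕ) : Set.InjOn (chainPoint j) (Set.Iio (8 ^ j)) := by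
  have key : ∀ a b, a < b → b < 8 ^ j → chainPoint j a ≠ chainPoint j b := by
    intro a b hab hb h
    have h0 := congrArg (fun z : Plane => z 0) h
    simp only [chainPoint_zero] at h0
    linarith [(nestedChain_slope j a b hab hb).1]
  intro a ha b hb h
  rcases lt_trichotomy a b with hab | hab | hab
  · exact absurd h (key a b hab hb)
  · exact hab
  · exact absurd h.symm (key b a hab ha)

/-- Blocks of size one show that no three points of the chain are collinear. -/
lemma inGeneralPosition_image {j N : ℕ} [DecidableEq Plane] (hN : N ≤ 8 ^ j) :
    InGeneralPosition ((Finset.range N).image (chainPoint j)) := by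
  intro a ha b hb c hc hab hac hbc hcol
  obtain ⟨k, hk, rfl⟩ := Finset.mem_image.1 ha
  obtain ⟨l, hl, rfl⟩ := Finset.mem_image.1 hb
  obtain ⟨m, hm, rfl⟩ := Finset.mem_image.1 hc
  rw [Finset.mem_range] at hk hl hm
  obtain ⟨u, v, w, huv, e1, e2, e3⟩ := exists_equation_of_collinear hab hcol
  simp only [chainPoint_zero, chainPoint_one] at e1 e2 e3
  have hit : ∀ r, u * (nestedChain j r).1 + v * (nestedChain j r).2 = w →
      HitsBlock j u v w 0 r := fun r hr => ⟨⟨r, by simp, hr.ge⟩, r, by simp, hr.le⟩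
  have h := not_hitsBlock_three j u v w huv 0 (Nat.zero_le j)
  simp only [Nat.sub_zero] at h
  have nkl : k ≠ l := fun h => hab (h ▸ rfl)
  have nkm : k ≠ m := fun h => hac (h ▸ rfl)
  have nlm : l ≠ m := fun h => hbc (h ▸ rfl)
  rcases nkl.lt_or_gt with h1 | h1 <;> rcases nkm.lt_or_gt with h2 | h2 <;>
    rcases nlm.lt_or_gt with h3 | h3
  · exact h k l m h1 h3 (by omega) (hit k e1) (hit l e2) (hit m e3)
  · exact h k m l h2 h3 (by omega) (hit k e1) (hit m e3) (hit l e2)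
  · omega
  · exact h m k l h2 h1 (by omega) (hit m e3) (hit k e1) (hit l e2)
  · exact h l k m h1 h2 (by omega) (hit l e2) (hit k e1) (hit m e3)
  · omega
  · exact h l m k h3 h2 (by omega) (hit l e2) (hit m e3) (hit k e1)
  · exact h m l k h3 h1 (by omega) (hit m e3) (hit l e2) (hit k e1)

lemma convexNumber_image_le {j N : ℕ} [DecidableEq Plane] (hN : N ≤ 8 ^ j) :
    convexNumber ((Finset.range N).image (chainPoint j)) ≤ 9 * 2 ^ j := by
  classical
  apply csSup_le'
  rintro n ⟨J, hJ, rfl⟩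
  set S := (Finset.range N).filter (fun a => chainPoint j a ∈ J) with hS
  have hW : WeaklyConvex j S := by
    intro a ha
    obtain ⟨u, v, huv, h⟩ := hJ.exists_supporting_line (Finset.mem_filter.1 ha).2
    exact ⟨u, v, huv, fun b hb => h _ (Finset.mem_filter.1 hb).2⟩
  have hcard := hW.card_le j S fun a ha =>
    (Finset.mem_range.1 (Finset.mem_filter.1 ha).1).trans_le hN
  have heq : (((Finset.range N).image (chainPoint j) : Finset Plane) : Set Plane) ∩ J =
      (S.image (chainPoint j) : Finset Plane) := by
    ext p
    simp only [hS, Set.mem_inter_iff, Finset.mem_coe, Finset.mem_image, Finset.mem_filter]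
    constructor
    · rintro ⟨⟨a, ha, rfl⟩, hp⟩
      exact ⟨a, ⟨ha, hp⟩, rfl⟩
    · rintro ⟨a, ⟨ha, hp⟩, rfl⟩
      exact ⟨⟨a, ha, rfl⟩, hp⟩
  rw [heq, Set.ncard_coe_finset]
  have := Finset.card_image_le (s := S) (f := chainPoint j)
  omega

/-- If `2 K < 8 ^ t`, then `K` lines leave unhit one of the `8 ^ t` blocks of size `8 ^ (j - t)` that
make up the first copy of the chain of level `j`,
and this block lies in one cell. -/
lemma le_maxCellCount_image {j t N : ℕ} [DecidableEq Plane] (htj : t ≤ j) (hjN : 8 ^ j ≤ N)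
    {A : Finset (AffineSubspace ℝ Plane)} (hA : IsSimpleArrangement A)
    (hK : 2 * A.card < 8 ^ t) :
    8 ^ (j - t) ≤ maxCellCount A ((Finset.range N).image (chainPoint (j + 1))) := by
  classical
  set i := j - t with hi
  have hit : 8 ^ t * 8 ^ i = 8 ^ j := by rw [← pow_add, hi, Nat.add_sub_cancel' htj]
  have hpos : 0 < 8 ^ i := by positivity
  have : ∀ ℓ : A, ∃ e : ℝ × ℝ × ℝ, (e.1 ≠ 0 ∨ e.2.1 ≠ 0) ∧
      ∀ p : Plane, p ∈ (ℓ : AffineSubspace ℝ Plane) ↔ e.1 * p 0 + e.2.1 * p 1 = e.2.2 := by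
    rintro ⟨ℓ, hℓ⟩
    obtain ⟨u, v, w, h⟩ := exists_line_equation (hA.line ℓ hℓ)
    exact ⟨(u, v, w), h⟩
  choose e he hmem using this
  set hits : A → Finset ℕ := fun ℓ => (Finset.range (8 ^ t)).filter
    (HitsBlock (j + 1) (e ℓ).1 (e ℓ).2.1 (e ℓ).2.2 i) with hhits
  have hcard : ∀ ℓ, (hits ℓ).card ≤ 2 := by
    intro ℓ
    by_contra hcon
    have h3 := not_le.1 hcon
    set o := (hits ℓ).orderEmbOfFin rfl with ho
    have hm : ∀ k, o k ∈ hits ℓ := fun k => Finset.orderEmbOfFin_mem _ _ _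
    have hlt : ∀ k, o k < 8 ^ t := fun k => Finset.mem_range.1 (Finset.mem_filter.1 (hm k)).1
    have hh := fun k => (Finset.mem_filter.1 (hm k)).2
    refine not_hitsBlock_three (j + 1) _ _ _ (he ℓ) i (by omega)
      (o ⟨0, by omega⟩) (o ⟨1, by omega⟩) (o ⟨2, by omega⟩) (o.strictMono (by simp))
      (o.strictMono (by simp)) ((hlt _).trans_le (Nat.pow_le_pow_right (by norm_num) (by omega)))
      (hh _) (hh _) (hh _)
  obtain ⟨q, hq, hqn⟩ : ∃ q ∈ Finset.range (8 ^ t), q ∉ Finset.univ.biUnion hits := by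
    apply Finset.exists_mem_notMem_of_card_lt_card
    have h1 := Finset.card_biUnion_le_card_mul Finset.univ hits 2 fun ℓ _ => hcard ℓ
    rw [Finset.card_univ, Fintype.card_coe] at h1
    rw [Finset.card_range]
    omega
  rw [Finset.mem_range] at hq
  have hqhit : ∀ ℓ, ¬ HitsBlock (j + 1) (e ℓ).1 (e ℓ).2.1 (e ℓ).2.2 i q := by
    intro ℓ h
    apply hqn
    rw [Finset.mem_biUnion]
    exact ⟨ℓ, Finset.mem_univ _, Finset.mem_filter.2 ⟨Finset.mem_range.2 hq, h⟩⟩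
  set I := Finset.Ico (q * 8 ^ i) ((q + 1) * 8 ^ i) with hI
  have hIdiv : ∀ a ∈ I, a / 8 ^ i = q := by
    intro a ha
    rw [hI, Finset.mem_Ico] at ha
    exact Nat.div_eq_of_lt_le ha.1 ha.2
  have hIlt : ∀ a ∈ I, a < 8 ^ j := by
    intro a ha
    rw [hI, Finset.mem_Ico] at ha
    have : (q + 1) * 8 ^ i ≤ 8 ^ t * 8 ^ i := Nat.mul_le_mul_right _ hq
    omega
  have hj1 : 8 ^ j ≤ 8 ^ (j + 1) := Nat.pow_le_pow_right (by norm_num) (by omega)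
  set T := I.image (chainPoint (j + 1)) with hT
  have hTcard : T.card = 8 ^ i := by
    rw [hT, Finset.card_image_of_injOn, hI, Nat.card_Ico, add_mul, one_mul,
      Nat.add_sub_cancel_left]
    intro a ha b hb
    exact chainPoint_injOn (j + 1) ((hIlt a ha).trans_le hj1) ((hIlt b hb).trans_le hj1)
  have hTX : T ⊆ (Finset.range N).image (chainPoint (j + 1)) :=
    Finset.image_subset_image fun a ha => Finset.mem_range.2 ((hIlt a ha).trans_le hjN)
  have hside : ∀ ℓ : A, ∃ H : Set Plane, Convex ℝ H ∧ (T : Set Plane) ⊆ H ∧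
      Disjoint H ((ℓ : AffineSubspace ℝ Plane) : Set Plane) := by
    intro ℓ
    have hlin : IsLinearMap ℝ fun p : Plane => (e ℓ).1 * p 0 + (e ℓ).2.1 * p 1 := by
      constructor <;> intros <;> simp <;> ring
    have h := hqhit ℓ
    rw [HitsBlock, not_and_or] at h
    push Not at h
    rcases h with h | h
    · refine ⟨_, convex_halfSpace_lt hlin (e ℓ).2.2, ?_, ?_⟩
      · intro p hp
        obtain ⟨a, ha, rfl⟩ := Finset.mem_image.1 (Finset.mem_coe.1 hp)
        exact h a (hIdiv a ha)
      · rw [Set.disjoint_left]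
        intro p hp hpl
        exact hp.ne ((hmem ℓ p).1 hpl)
    · refine ⟨_, convex_halfSpace_gt hlin (e ℓ).2.2, ?_, ?_⟩
      · intro p hp
        obtain ⟨a, ha, rfl⟩ := Finset.mem_image.1 (Finset.mem_coe.1 hp)
        exact h a (hIdiv a ha)
      · rw [Set.disjoint_left]
        intro p hp hpl
        exact hp.ne' ((hmem ℓ p).1 hpl)
  choose H hHc hHT hHd using hside
  have hTH : (T : Set Plane) ⊆ ⋂ ℓ, H ℓ := Set.subset_iInter hHT
  have hTne : (T : Set Plane).Nonempty := by
    rw [Finset.coe_nonempty, ← Finset.card_pos, hTcard]; exact hpos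
  obtain ⟨c, hc, hcl⟩ := exists_isCell_of_convex (A := A) (convex_iInter hHc)
    (hTne.mono hTH) (by
      intro p hp hpU
      simp only [arrangementUnion, Set.mem_iUnion] at hpU
      obtain ⟨ℓ, hℓ, hpl⟩ := hpU
      exact Set.disjoint_left.1 (hHd ⟨ℓ, hℓ⟩) (Set.mem_iInter.1 hp _) hpl)
  rw [← hTcard]
  exact le_maxCellCount hc hTX (hTH.trans (subset_closure.trans hcl))

lemma le_mul_maxCellCount_image {j N : ℕ} [DecidableEq Plane] (hjN : 8 ^ j ≤ N)
    (hN : N < 8 ^ (j + 1)) {A : Finset (AffineSubspace ℝ Plane)} (hA : IsSimpleArrangement A)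
    (hK : 1 ≤ A.card) :
    N ≤ 128 * A.card * maxCellCount A ((Finset.range N).image (chainPoint (j + 1))) := by
  have hlog := Nat.pow_log_le_self 8 (x := 2 * A.card) (by omega)
  have hlog' := Nat.lt_pow_succ_log_self (b := 8) (by norm_num) (2 * A.card)
  set t := Nat.log 8 (2 * A.card) with ht
  rw [pow_succ] at hN
  rcases Nat.lt_or_ge t j with h | h
  · have h1 := le_maxCellCount_image (N := N) (t := t + 1) h hjN hA hlog'
    have h2 : 8 ^ j = 8 * 8 ^ t * 8 ^ (j - (t + 1)) := by
      rw [mul_comm 8, ← pow_succ, ← pow_add, Nat.add_sub_cancel' h]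
    calc N ≤ 8 ^ j * 8 := hN.le
      _ = 64 * 8 ^ t * 8 ^ (j - (t + 1)) := by rw [h2]; ring
      _ ≤ 64 * (2 * A.card) * maxCellCount A _ :=
        Nat.mul_le_mul (Nat.mul_le_mul_left _ hlog) h1
      _ = _ := by ring
  · -- so many lines that a single point in a cell is enough
    have h1 : 8 ^ j ≤ 8 ^ t := Nat.pow_le_pow_right (by norm_num) h
    have h8 : 0 < 8 ^ j := by positivity
    obtain ⟨c, hc, hpc⟩ := exists_isCell_mem hA.line (chainPoint (j + 1) 0)
    have h2 := le_maxCellCount (X := (Finset.range N).image (chainPoint (j + 1)))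
      (T := {chainPoint (j + 1) 0}) hc
      (by
        rw [Finset.singleton_subset_iff]
        exact Finset.mem_image_of_mem _ (Finset.mem_range.2 (by omega)))
      (by simpa using hpc)
    rw [Finset.card_singleton] at h2
    calc N ≤ 128 * A.card * 1 := by omega
      _ ≤ _ := Nat.mul_le_mul_left _ h2

/-- The cutting number is a minimum, attained by some simple arrangement. -/
lemma exists_cuttingNumber_eq (K : ℕ) (X : Finset Plane) :
    ∃ A, IsSimpleArrangement A ∧ A.card = K ∧ cuttingNumber K X = maxCellCount A X := by
  obtain ⟨A, hA, hAK⟩ := exists_isSimpleArrangement K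
  exact Nat.sInf_mem (s := {m : ℕ | ∃ A : Finset (AffineSubspace ℝ Plane),
    IsSimpleArrangement A ∧ A.card = K ∧ m = maxCellCount A X}) ⟨_, A, hA, hAK, rfl⟩

theorem theorem3p2 :
    ∃ C c : ℝ, 0 < C ∧ 0 < c ∧
      ∀ N : ℕ, ∃ X : Finset Plane, X.card = N ∧ InGeneralPosition X ∧
        (convexNumber X : ℝ) ≤ C * (N : ℝ) ^ (1 / 3 : ℝ) ∧
        ∀ K : ℕ, 1 ≤ K → c * ((N : ℝ) / (K : ℝ)) ≤ (cuttingNumber K X : ℝ) := by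
  classical
  refine ⟨18, 1 / 128, by norm_num, by norm_num, fun N => ?_⟩
  rcases Nat.eq_zero_or_pos N with rfl | hN
  · refine ⟨∅, rfl, fun a ha => by simp at ha, ?_, fun K _ => by simp⟩
    have : convexNumber ∅ ≤ 0 := by
      apply csSup_le'
      rintro n ⟨J, _, rfl⟩
      simp
    have : convexNumber ∅ = 0 := by omega
    rw [this]
    simp
  have hjN := Nat.pow_log_le_self 8 (x := N) (by omega)
  have hNj := Nat.lt_pow_succ_log_self (b := 8) (by norm_num) N
  set j := Nat.log 8 N with hj
  -- `N` points of the chain of level `j + 1` include its whole first copy of the chain of level `j`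
  refine ⟨(Finset.range N).image (chainPoint (j + 1)), ?_, inGeneralPosition_image hNj.le, ?_, ?_⟩
  · rw [Finset.card_image_of_injOn, Finset.card_range]
    intro a ha b hb
    simp only [Finset.coe_range, Set.mem_Iio] at ha hb
    exact chainPoint_injOn (j + 1) (ha.trans hNj) (hb.trans hNj)
  · have h1 : (convexNumber ((Finset.range N).image (chainPoint (j + 1))) : ℝ) ≤
        9 * 2 ^ (j + 1) := by
      exact_mod_cast convexNumber_image_le hNj.le
    have h2 : (2 : ℝ) ^ j ≤ (N : ℝ) ^ (1 / 3 : ℝ) := by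
      have h3 : ((8 : ℝ) ^ j) ^ (1 / 3 : ℝ) ≤ (N : ℝ) ^ (1 / 3 : ℝ) :=
        Real.rpow_le_rpow (by positivity) (by exact_mod_cast hjN) (by norm_num)
      have h4 : ((8 : ℝ) ^ j) = (2 ^ j) ^ 3 := by
        rw [← pow_mul, mul_comm, pow_mul]; norm_num
      rw [h4, one_div] at h3
      rw [one_div]
      have h5 := Real.pow_rpow_inv_natCast (x := 2 ^ j) (n := 3) (by positivity) (by norm_num)
      push_cast at h5
      rwa [h5] at h3
    rw [pow_succ] at h1
    linarith
  · intro K hK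
    obtain ⟨A, hA, rfl, hcut⟩ := exists_cuttingNumber_eq K
      ((Finset.range N).image (chainPoint (j + 1)))
    have h1 : (N : ℝ) ≤ 128 * A.card *
        maxCellCount A ((Finset.range N).image (chainPoint (j + 1))) := by
      exact_mod_cast le_mul_maxCellCount_image hjN hNj hA hK
    have hK' : (0 : ℝ) < A.card := by exact_mod_cast hK
    rw [hcut, ← mul_div_assoc, div_le_iff₀ hK']
    linarith
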